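/- Consider a single-route transit system with stations $1,\dots,N$, vehicle capacity $C$, incident-free cycle time $\bar E>0$, fleet size $\bar F>0$, nominal headway $\bar H=\bar E/\bar F$, incident-free travel times $T^{(n)}>0$ from the hub to station $n$, passenger arrival rates $\lambda^{(n)}\ge 0$, incident rate $\gamma\ge 0$ and exponential incident durations of rate $\theta>0$. Put $$\mu=\bar H+\frac{2\gamma T^{(N)}}{\theta\bar F},\qquad \sigma=\frac{2\sqrt{T^{(n)}\gamma}}{\theta},\qquad \hat H^{(n)}_{\mathrm{Normal}}=\max(H,0)\ \text{ with } H\sim\mathcal N(\mu,\sigma^2),$$ and let $Y^{(n)}$, given $\hat H^{(n)}_{\mathrm{Normal}}$, be Poisson with parameter $\lambda^{(n)}\hat H^{(n)}_{\mathrm{Normal}}$. The bulk-service queue at station $n$ is $Q^{(n,l+1)}=\max(Q^{(n,l)}-S^{(n,l)},0)+Y^{(n,l)}$, $l=1,2,\dots$, where for every $l$ the queue length $Q^{(n,l)}$ found by vehicle $l$, the available space $S^{(n,l)}\in\{0,\dots,C\}$ in vehicle $l$, and the number $Y^{(n,l)}$ of arrivals before the next vehicle are independent, $Y^{(n,l)}$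 is distributed as $Y^{(n)}$, and $P(S^{(n,l)}=u)\to s^{(n)}_u$ as $l\to\infty$ for every $u$, where $s^{(n)}$ is a probability distribution on $\{0,\dots,C\}$ with $\bar S^{(n)}=\sum_{u=0}^C u\,s^{(n)}_u>0$. The queue is called stable if it has a steady-state distribution, that is, if there is a probability distribution $(q_k)_{k\ge 0}$ such that for every distribution of $Q^{(n,1)}$ and every $k$, $P(Q^{(n,l)}=k)\to q_k$ as $l\to\infty$. Then $Y^{(n)}$ and $\hat H^{(n)}_{\mathrm{Normal}}$ have finite means, and with $\bar Y^{(n)}=E[Y^{(n)}]$ the queue at station $n$ is stable if and only if $$\rho^{(n)}=\frac{\bar Y^{(n)}}{\bar S^{(n)}}=\frac{\lambda^{(n)}\,E[\hat H^{(n)}_{\mathrm{Normal}}]}{\sum_{u=0}^C u\,s^{(n)}_u}<1.$$ Moreover, if $\gamma>0$ (so that $\sigma>0$), $$\rho^{(n)}=\frac{\left(\mu\,\Phi\!\left(\frac{\mu}{\sigma}\right)+\sigma\,\varphi\!\left(\frac{-\mu}{\sigma}\right)\right)\lambda^{(n)}}{\sum_{u=0}^C u\,s^{(n)}_u},$$ where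 $\Phi$ and $\varphi$ are the distribution function and the density of the standard normal distribution. -/

import Mathlib

open MeasureTheory ProbabilityTheory Filter Topology
open scoped NNReal ENNReal

/-- The data of a single-route public transit system under random service suspensions. Stations
are numbered `1, …, numStations`; only these values of `arrivalRate` and `travelTime` matter. -/
structure TransitRoute where
  /-- The number `N` of stations. -/
  numStations : ℕ
  /-- The vehicle capacity `C`. -/
  capacity : ℕ
  /-- The route cycle time without incidents. -/
  cycleTime : ℝ
  cycleTime_pos : 0 < cycleTime
  /-- The fleet size. -/
  fleetSize : ℝ
  fleetSize_pos : 0 < fleetSize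
  /-- The Poisson rate at which passengers arrive at station `n`. -/
  arrivalRate : ℕ → ℝ
  arrivalRate_nonneg : ∀ n, 1 ≤ n → n ≤ numStations → 0 ≤ arrivalRate n
  /-- The incident-free travel time from the hub to station `n`. -/
  travelTime : ℕ → ℝ
  travelTime_pos : ∀ n, 1 ≤ n → n ≤ numStations → 0 < travelTime n
  /-- The rate `γ` at which incidents occur while a vehicle is travelling. -/
  incidentRate : ℝ
  incidentRate_nonneg : 0 ≤ incidentRate
  /-- The rate `θ` of the exponential duration of an incident. -/
  recoveryRate : ℝ
  recoveryRate_pos : 0 < recoveryRate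

noncomputable section

namespace TransitRoute

variable (R : TransitRoute)

/-- The nominal headway: cycle time over fleet size. -/
def nominalHeadway : ℝ := R.cycleTime / R.fleetSize

/-- The mean `μ` of the headway, the nominal headway plus the planned adjustment for the mean total
incident duration `γ T / θ` on the way to the last station, in both directions. -/
def headwayMean : ℝ :=
  R.nominalHeadway +
    2 * R.incidentRate * R.travelTime R.numStations / (R.recoveryRate * R.fleetSize)

/-- The standard deviation `σ` of the headway at station `n`. -/
def headwaySD (n : ℕ) : ℝ :=
  2 * √(R.travelTime n * R.incidentRate) / R.recoveryRate

/-- The law of the normal headway at station `n`, truncated at zero with the mass of the negative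
half-line put at zero (no overtaking): the law of `max H 0` for `H` normal with mean `μ` and
standard deviation `σ`. -/
def headwayLaw (n : ℕ) : Measure ℝ :=
  (gaussianReal R.headwayMean (Real.toNNReal (R.headwaySD n ^ 2))).map (fun h => max h 0)

/-- The law of the number `Y` of passengers that arrive at station `n` within a headway: given the
truncated headway `h`, it is Poisson with parameter `arrivalRate n * h`. -/
def arrivalLaw (n : ℕ) : Measure ℕ :=
  (R.headwayLaw n).bind (fun h => poissonMeasure (Real.toNNReal (R.arrivalRate n * h)))

/-- The mean number of passengers that arrive at station `n` within a headway. -/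
def meanArrivals (n : ℕ) : ℝ := ∫ k, (k : ℝ) ∂(R.arrivalLaw n)

/-- The mixing family in `arrivalLaw` is measurable, so that the mixture is a genuine one. -/
theorem measurable_poisson_family (n : ℕ) :
    Measurable (fun h : ℝ => poissonMeasure (Real.toNNReal (R.arrivalRate n * h))) := by
  refine Measure.measurable_of_measurable_coe _ fun t ht => ?_
  simp only [poissonMeasure]
  simp_rw [Measure.sum_apply _ ht, Measure.smul_apply]
  refine Measurable.tsum fun k => ?_
  simp only [smul_eq_mul]
  fun_prop

instance (n : ℕ) : IsProbabilityMeasure (R.headwayLaw n) :=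
  Measure.isProbabilityMeasure_map (by fun_prop)

instance (n : ℕ) : IsProbabilityMeasure (R.arrivalLaw n) :=
  isProbabilityMeasure_bind (R.measurable_poisson_family n).aemeasurable
    (ae_of_all _ fun _ => inferInstance)

end TransitRoute

/-- The mean `∑ u, u * s u` of a law `s` of the available space in a vehicle of capacity `C`. -/
def meanSpace {C : ℕ} (s : PMF (Fin (C + 1))) : ℝ :=
  ∑ u : Fin (C + 1), ((u : ℕ) : ℝ) * (s u).toReal

/-- The law of the queue length found by successive vehicles in the bulk-service queue. The first
vehicle finds a queue with law `q₁`. Vehicle `l` finds `Q` passengers waiting and has `S` spaces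
available, with law `s l`; it leaves `Q - S` passengers behind, or none if `Q ≤ S`
(the subtraction of natural numbers), and then `Y` passengers arrive, with law `y`, before the next
vehicle comes. Here `Q`, `S` and `Y` are independent. -/
def queueLaw {C : ℕ} (s : ℕ → PMF (Fin (C + 1))) (y q₁ : Measure ℕ) : ℕ → Measure ℕ
  | 0 => q₁
  | l + 1 => ((queueLaw s y q₁ l).prod ((s l).toMeasure.prod y)).map
      (fun p : ℕ × Fin (C + 1) × ℕ => (p.1 - (p.2.1 : ℕ)) + p.2.2)

/-- The queue is stable if its length has a steady-state distribution: there is a probability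
distribution `q` on the natural numbers such that, whatever the initial distribution, the
probability that a vehicle finds `k` passengers waiting tends to `q k`, for every `k`. -/
def IsStableQueue {C : ℕ} (s : ℕ → PMF (Fin (C + 1))) (y : Measure ℕ) : Prop :=
  ∃ q : Measure ℕ, IsProbabilityMeasure q ∧
    ∀ q₁ : Measure ℕ, IsProbabilityMeasure q₁ →
      ∀ k : ℕ, Tendsto (fun l => (queueLaw s y q₁ l).real {k}) atTop (𝓝 (q.real {k}))

/-- The utilization ratio at station `n`, for the steady-state law `s` of the available space. -/
def TransitRoute.utilization (R : TransitRoute) (n : ℕ) (s : PMF (Fin (R.capacity + 1))) : ℝ :=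
  R.meanArrivals n / meanSpace s

end

/-!
The number of passengers at station `n` is a Markov chain with transition `x ↦ (x - S) + Y`, whose
law of `S` depends on time and converges. The arrivals `Y` are a Poisson variable mixed over a
truncated normal headway, so `E Y = λ E Ĥ`, all exponential moments are finite, and `Y = 0` has
positive probability. Everything but the explicit formula for `E Ĥ`, which is a Gaussian integral
(`integral_max_zero_gaussianReal`), follows from the stability criterion `E Y < E S` for such
chains, `isStableQueue_iff_integral_lt_meanSpace`.

*Stability implies `E Y < E S`.* The limit law `q` is invariant under the limiting transition
(`integral_queueStep_eq_of_tendsto`). The mean drift under an invariant law vanishes, which after a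
truncation says `E Y = E min(Q, S)` (`integral_drift_eq_zero_of_stationary`), and `q` charges the
empty queue (`real_singleton_zero_pos_of_stationary`), where `min(Q, S) = 0`. Hence `E Y < E S`, also
in the critical case.

*`E Y < E S` implies stability.* For some `t > 0` the number `b = E exp (t (Y - S))` is below one.
Two queues driven by the same `S` and `Y` merge as soon as the longer one is emptied, and until then
the longer one moves by `Y - S` exactly; so the transition operator contracts differences weighted
by `exp (t z)`, `z` the longer queue, by the factor `b` (`abs_queueStep_sub_le`). Neither
irreducibility nor aperiodicity is needed. For the limiting queue this produces the steady state and
a geometric speed of convergence to it (`exists_stationary_abs_iterate_sub_le`). The time-dependent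
queue has bounded exponential moments (`exists_eventually_integral_exp_le`) and over any fixed number
of late steps it is close to the limiting queue (`tendsto_integral_queueLaw_add_sub`); hence it
converges to the same steady state.
-/

/-! ### The transition operator of the queue -/

/-- The transition operator of the bulk-service queue: `queueStep p y f x` is the mean of `f Q'`,
where `Q' = (x - S) + Y` is the queue length one vehicle later, given that the present vehicle finds
`x` passengers, for independent `S` with law `p` and `Y` with law `y`. -/
noncomputable def queueStep {C : ℕ} (p : PMF (Fin (C + 1))) (y : Measure ℕ) (f : ℕ → ℝ) (x : ℕ) :
    ℝ :=
  ∑ u : Fin (C + 1), (p u).toReal * ∫ k, f (x - (u : ℕ) + k) ∂y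

theorem PMF.sum_toReal_eq_one {C : ℕ} (p : PMF (Fin (C + 1))) : ∑ u, (p u).toReal = 1 := by
  rw [← ENNReal.toReal_sum fun u _ => p.apply_ne_top u, ← tsum_fintype (L := .unconditional _),
    p.tsum_coe, ENNReal.toReal_one]

theorem MeasureTheory.integrable_of_abs_le {ν : Measure ℕ} [IsFiniteMeasure ν] {f : ℕ → ℝ} {c : ℝ}
    (hf : ∀ x, |f x| ≤ c) : Integrable f ν :=
  Integrable.of_bound (f := f) Measurable.of_discrete.aestronglyMeasurable c (ae_of_all _ hf)

theorem MeasureTheory.abs_integral_le_of_abs_le {ν : Measure ℕ} [IsProbabilityMeasure ν]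
    {f : ℕ → ℝ} {c : ℝ} (hf : ∀ x, |f x| ≤ c) : |∫ x, f x ∂ν| ≤ c := by
  simpa using norm_integral_le_of_norm_le_const (μ := ν) (f := f) (ae_of_all _ hf)

section Step

variable {C : ℕ} {s : ℕ → PMF (Fin (C + 1))} {y q₁ : Measure ℕ}

theorem isProbabilityMeasure_queueLaw [IsProbabilityMeasure y] [IsProbabilityMeasure q₁] (l : ℕ) :
    IsProbabilityMeasure (queueLaw s y q₁ l) := by
  induction l with
  | zero => assumption
  | succ l ih => exact Measure.isProbabilityMeasure_map Measurable.of_discrete.aemeasurable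

/-- Duality between the transition operator and the evolution of the law of the queue length. -/
theorem integral_queueLaw_succ [IsProbabilityMeasure y] [IsProbabilityMeasure q₁] {l : ℕ}
    {f : ℕ → ℝ} (hf : Integrable f (queueLaw s y q₁ (l + 1))) :
    ∫ x, f x ∂(queueLaw s y q₁ (l + 1)) = ∫ x, queueStep (s l) y f x ∂(queueLaw s y q₁ l) := by
  have := isProbabilityMeasure_queueLaw (s := s) (y := y) (q₁ := q₁) l
  rw [queueLaw] at hf ⊢
  have hm : AEMeasurable (fun p : ℕ × Fin (C + 1) × ℕ => (p.1 - (p.2.1 : ℕ)) + p.2.2)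
      ((queueLaw s y q₁ l).prod ((s l).toMeasure.prod y)) := Measurable.of_discrete.aemeasurable
  have hi : Integrable (fun p : ℕ × Fin (C + 1) × ℕ => f (p.1 - (p.2.1 : ℕ) + p.2.2))
      ((queueLaw s y q₁ l).prod ((s l).toMeasure.prod y)) := hf.comp_aemeasurable hm
  rw [integral_map hm Measurable.of_discrete.aestronglyMeasurable, integral_prod _ hi]
  refine integral_congr_ae ?_
  filter_upwards [hi.prod_right_ae] with x hx
  rw [integral_prod _ hx, PMF.integral_eq_sum]
  simp [queueStep]

theorem abs_queueStep_le [IsProbabilityMeasure y] {p : PMF (Fin (C + 1))} {f : ℕ → ℝ} {c : ℝ}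
    (hf : ∀ x, |f x| ≤ c) (x : ℕ) : |queueStep p y f x| ≤ c := by
  calc |queueStep p y f x| ≤ ∑ u : Fin (C + 1), |(p u).toReal * ∫ k, f (x - (u : ℕ) + k) ∂y| :=
        Finset.abs_sum_le_sum_abs _ _
    _ ≤ ∑ u : Fin (C + 1), (p u).toReal * c := by
        refine Finset.sum_le_sum fun u _ => ?_
        rw [abs_mul, abs_of_nonneg ENNReal.toReal_nonneg]
        exact mul_le_mul_of_nonneg_left (abs_integral_le_of_abs_le fun k => hf _)
          ENNReal.toReal_nonneg
    _ = c := by rw [← Finset.sum_mul, PMF.sum_toReal_eq_one, one_mul]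

theorem tendsto_toReal_apply {s_lim : PMF (Fin (C + 1))}
    (hs : ∀ u, Tendsto (fun l => s l u) atTop (𝓝 (s_lim u))) (u : Fin (C + 1)) :
    Tendsto (fun l => (s l u).toReal) atTop (𝓝 (s_lim u).toReal) :=
  (ENNReal.tendsto_toReal (s_lim.apply_ne_top u)).comp (hs u)

end Step

/-! ### A stable queue has utilization below one -/

theorem MeasureTheory.integrable_of_eq_zero_of_le {ν : Measure ℕ} [IsFiniteMeasure ν]
    {f : ℕ → ℝ} {N : ℕ} (hf : ∀ x, N ≤ x → f x = 0) : Integrable f ν := by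
  refine integrable_of_abs_le (c := ∑ x ∈ Finset.range N, |f x|) fun x => ?_
  by_cases hx : x < N
  · exact Finset.single_le_sum (f := fun x => |f x|) (fun _ _ => abs_nonneg _)
      (Finset.mem_range.2 hx)
  · rw [hf x (not_lt.1 hx), abs_zero]
    exact Finset.sum_nonneg fun _ _ => abs_nonneg _

theorem MeasureTheory.integral_eq_sum_range_of_eq_zero (ν : Measure ℕ) [IsFiniteMeasure ν]
    {f : ℕ → ℝ} {N : ℕ} (hf : ∀ x, N ≤ x → f x = 0) :
    ∫ x, f x ∂ν = ∑ x ∈ Finset.range N, ν.real {x} * f x := by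
  rw [integral_countable (integrable_of_eq_zero_of_le hf), tsum_eq_sum (s := Finset.range N)]
  · rfl
  · intro x hx
    rw [hf x (by simpa using hx), smul_zero]

section Necessity

variable {C : ℕ} {s : ℕ → PMF (Fin (C + 1))} {s_lim : PMF (Fin (C + 1))} {y q : Measure ℕ}

theorem queueStep_eq_zero {p : PMF (Fin (C + 1))} {f : ℕ → ℝ} {N : ℕ}
    (hf : ∀ x, N ≤ x → f x = 0) {x : ℕ} (hx : N + C ≤ x) : queueStep p y f x = 0 := by
  refine Finset.sum_eq_zero fun u _ => ?_
  have : ∀ k, f (x - (u : ℕ) + k) = 0 := fun k => hf _ (by have := u.isLt; omega)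
  simp [this]

/-- The limit of the laws of the queue length is invariant under the limiting transition operator.
Test functions of finite support are enough below; on them only finitely many of the pointwise
limits are used. -/
theorem integral_queueStep_eq_of_tendsto [IsProbabilityMeasure y] [IsProbabilityMeasure q]
    {q₁ : Measure ℕ} [IsProbabilityMeasure q₁]
    (hs : ∀ u, Tendsto (fun l => s l u) atTop (𝓝 (s_lim u)))
    (hq : ∀ k, Tendsto (fun l => (queueLaw s y q₁ l).real {k}) atTop (𝓝 (q.real {k})))
    {f : ℕ → ℝ} {N : ℕ} (hf : ∀ x, N ≤ x → f x = 0) :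
    ∫ x, queueStep s_lim y f x ∂q = ∫ x, f x ∂q := by
  have hpr := fun l => isProbabilityMeasure_queueLaw (s := s) (y := y) (q₁ := q₁) l
  have h1 : Tendsto (fun l => ∫ x, f x ∂(queueLaw s y q₁ l)) atTop (𝓝 (∫ x, f x ∂q)) := by
    simp_rw [integral_eq_sum_range_of_eq_zero _ hf]
    exact tendsto_finsetSum _ fun x _ => (hq x).mul_const _
  have h2 : Tendsto (fun l => ∫ x, queueStep (s l) y f x ∂(queueLaw s y q₁ l)) atTop
      (𝓝 (∫ x, queueStep s_lim y f x ∂q)) := by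
    simp_rw [integral_eq_sum_range_of_eq_zero _ fun x hx => queueStep_eq_zero (N := N) hf hx]
    refine tendsto_finsetSum _ fun x _ => (hq x).mul ?_
    exact tendsto_finsetSum _ fun u _ => (tendsto_toReal_apply hs u).mul_const _
  refine tendsto_nhds_unique h2 ?_
  have h3 := h1.comp (tendsto_add_atTop_nat 1)
  exact h3.congr fun l => integral_queueLaw_succ (integrable_of_eq_zero_of_le hf)

/-- A stationary queue is empty with positive probability: from the smallest queue length in the
support of its law, a vehicle with free space and no arrivals would lead to a smaller one. -/
theorem real_singleton_zero_pos_of_stationary [IsProbabilityMeasure y] [IsProbabilityMeasure q]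
    (hy0 : 0 < y.real {0}) (hpos : 0 < meanSpace s_lim)
    (hst : ∀ (f : ℕ → ℝ) (N : ℕ), (∀ x, N ≤ x → f x = 0) →
      ∫ x, queueStep s_lim y f x ∂q = ∫ x, f x ∂q) :
    0 < q.real {0} := by
  classical
  have hex : ∃ k, 0 < q.real {k} := by
    by_contra! h
    have h0 : ∀ k, q {k} = 0 := fun k =>
      (measureReal_eq_zero_iff).1 (le_antisymm (h k) measureReal_nonneg)
    have : q = 0 := Measure.ext_of_singleton fun k => by simp [h0]
    exact IsProbabilityMeasure.ne_zero q this
  obtain ⟨k, hk, hmin⟩ : ∃ k, 0 < q.real {k} ∧ ∀ j < k, ¬ 0 < q.real {j} :=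
    ⟨Nat.find hex, Nat.find_spec hex, fun j hj => Nat.find_min hex hj⟩
  rcases Nat.eq_zero_or_pos k with rfl | hk0
  · exact hk
  exfalso
  obtain ⟨u, -, hu⟩ : ∃ u ∈ (Finset.univ : Finset (Fin (C + 1))),
      0 < ((u : ℕ) : ℝ) * (s_lim u).toReal :=
    Finset.exists_lt_of_sum_lt (f := fun _ => (0 : ℝ)) (by simpa [meanSpace] using hpos)
  have hu0 : 0 < (u : ℕ) := by
    rcases Nat.eq_zero_or_pos (u : ℕ) with h | h
    · simp [h] at hu
    · exact h
  have hsu : 0 < (s_lim u).toReal := pos_of_mul_pos_right hu (by positivity)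
  refine hmin (k - u) (by omega) ?_
  set f : ℕ → ℝ := Set.indicator {k - (u : ℕ)} 1 with hf
  have hf0 : ∀ x, 0 ≤ f x := fun x => Set.indicator_nonneg (fun _ _ => by simp) x
  have hf1 : ∀ x, |f x| ≤ 1 := fun x => by
    rw [abs_of_nonneg (hf0 x)]
    exact Set.indicator_le_self' (f := fun _ => (1 : ℝ)) (fun _ _ => by simp) x
  have hfi : ∫ x, f x ∂q = q.real {k - (u : ℕ)} := integral_indicator_one (measurableSet_singleton _)
  rw [← hfi, ← hst f (k + 1) fun x hx => by
    rw [hf, Set.indicator_of_notMem]; simp only [Set.mem_singleton_iff]; omega]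
  have hnn : ∀ x, 0 ≤ queueStep s_lim y f x := fun x =>
    Finset.sum_nonneg fun v _ => mul_nonneg ENNReal.toReal_nonneg (integral_nonneg fun _ => hf0 _)
  have hle : (q.real {k}) * ((s_lim u).toReal * y.real {0}) ≤ ∫ x, queueStep s_lim y f x ∂q := by
    have hterm : y.real {0} ≤ ∫ j, f (k - (u : ℕ) + j) ∂y := by
      rw [← integral_indicator_one (measurableSet_singleton 0)]
      refine integral_mono (integrable_of_abs_le (c := 1) fun j => ?_)
        (integrable_of_abs_le fun j => hf1 _) fun j => ?_
      · by_cases hj : j = 0 <;> simp [hj]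
      · by_cases hj : j = 0
        · simp [hj, hf]
        · simpa [hj] using hf0 _
    have hk' : (s_lim u).toReal * y.real {0} ≤ queueStep s_lim y f k :=
      (mul_le_mul_of_nonneg_left hterm hsu.le).trans
        (Finset.single_le_sum (f := fun v : Fin (C + 1) =>
          (s_lim v).toReal * ∫ j, f (k - (v : ℕ) + j) ∂y)
          (fun v _ => mul_nonneg ENNReal.toReal_nonneg (integral_nonneg fun _ => hf0 _))
          (Finset.mem_univ u))
    calc _ ≤ q.real {k} * queueStep s_lim y f k := by gcongr
      _ = ∫ x, Set.indicator {k} (fun _ => queueStep s_lim y f k) x ∂q := by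
        rw [integral_indicator_const _ (measurableSet_singleton _), smul_eq_mul]
      _ ≤ _ := by
        refine integral_mono (integrable_of_abs_le (c := queueStep s_lim y f k) fun j => ?_)
          (integrable_of_abs_le fun j => abs_queueStep_le hf1 j) fun j => ?_
        · by_cases hj : j = k
          · simp [hj, abs_of_nonneg (hnn k)]
          · simp [hj, hnn k]
        · by_cases hj : j = k
          · simp [hj]
          · simpa [hj] using hnn j
  exact lt_of_lt_of_le (by positivity) hle

/-- Balance of arrivals and departures in a stationary queue: the mean of `min Q S` is that of `Y`.
No moment of the stationary law is assumed, so the means of `Q'` and `Q` cannot be subtracted; the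
functions `M - min x M` have finite support and bounded increments, and `M → ∞`. -/
theorem integral_drift_eq_zero_of_stationary [IsProbabilityMeasure y] [IsProbabilityMeasure q]
    (hy : Integrable (fun k : ℕ => (k : ℝ)) y)
    (hst : ∀ (f : ℕ → ℝ) (N : ℕ), (∀ x, N ≤ x → f x = 0) →
      ∫ x, queueStep s_lim y f x ∂q = ∫ x, f x ∂q) :
    ∫ x : ℕ, ∑ u : Fin (C + 1), (s_lim u).toReal * (((min x (u : ℕ) : ℕ) : ℝ) - ∫ k, (k : ℝ) ∂y) ∂q
      = 0 := by
  set f : ℕ → ℕ → ℝ := fun M x => (M : ℝ) - ((min x M : ℕ) : ℝ) with hf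
  have hfb : ∀ M x, |f M x| ≤ M := fun M x => by
    have h1 : ((min x M : ℕ) : ℝ) ≤ M := by exact_mod_cast min_le_right x M
    have h2 : (0 : ℝ) ≤ ((min x M : ℕ) : ℝ) := by positivity
    rw [hf, abs_le]; constructor <;> dsimp only <;> linarith
  have hinc : ∀ M x (u : Fin (C + 1)) k, |f M (x - (u : ℕ) + k) - f M x| ≤ C + k := by
    intro M x u k
    have h1 : min x M ≤ min (x - (u : ℕ) + k) M + (C + k) := by have := u.isLt; omega
    have h2 : min (x - (u : ℕ) + k) M ≤ min x M + (C + k) := by omega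
    have h1' : ((min x M : ℕ) : ℝ) ≤ (min (x - (u : ℕ) + k) M : ℕ) + (C + k) := by exact_mod_cast h1
    have h2' : ((min (x - (u : ℕ) + k) M : ℕ) : ℝ) ≤ (min x M : ℕ) + (C + k) := by exact_mod_cast h2
    simp only [hf]
    rw [abs_le]; constructor <;> linarith
  have hbi : Integrable (fun k : ℕ => (C : ℝ) + k) y := (integrable_const _).add hy
  have hstep : ∀ M x, queueStep s_lim y (f M) x - f M x =
      ∑ u : Fin (C + 1), (s_lim u).toReal * ∫ k, (f M (x - (u : ℕ) + k) - f M x) ∂y := by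
    intro M x
    have : ∀ u : Fin (C + 1), ∫ k, (f M (x - (u : ℕ) + k) - f M x) ∂y =
        (∫ k, f M (x - (u : ℕ) + k) ∂y) - f M x := fun u => by
      rw [integral_sub (integrable_of_abs_le fun k => hfb M _) (integrable_const _)]
      simp
    simp_rw [this, mul_sub, Finset.sum_sub_distrib, ← Finset.sum_mul, PMF.sum_toReal_eq_one]
    simp [queueStep]
  have hzero : ∀ M, ∫ x, (queueStep s_lim y (f M) x - f M x) ∂q = 0 := fun M => by
    rw [integral_sub (integrable_of_abs_le fun x => abs_queueStep_le (hfb M) x)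
      (integrable_of_abs_le (hfb M)), hst (f M) M fun x hx => by simp [hf, hx], sub_self]
  have hlim : Tendsto (fun M => ∫ x, (queueStep s_lim y (f M) x - f M x) ∂q) atTop
      (𝓝 (∫ x : ℕ, ∑ u : Fin (C + 1),
        (s_lim u).toReal * (((min x (u : ℕ) : ℕ) : ℝ) - ∫ k, (k : ℝ) ∂y) ∂q)) := by
    refine tendsto_integral_of_dominated_convergence (fun _ => ∫ k, ((C : ℝ) + k) ∂y)
      (fun _ => Measurable.of_discrete.aestronglyMeasurable) (integrable_const _)
      (fun M => ae_of_all _ fun x => ?_) (ae_of_all _ fun x => ?_)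
    · rw [hstep, Real.norm_eq_abs]
      refine (Finset.abs_sum_le_sum_abs _ _).trans ?_
      calc _ ≤ ∑ u : Fin (C + 1), (s_lim u).toReal * ∫ k, ((C : ℝ) + k) ∂y := by
            refine Finset.sum_le_sum fun u _ => ?_
            rw [abs_mul, abs_of_nonneg ENNReal.toReal_nonneg]
            refine mul_le_mul_of_nonneg_left ?_ ENNReal.toReal_nonneg
            exact norm_integral_le_of_norm_le (f := fun k => f M (x - (u : ℕ) + k) - f M x) hbi
              (ae_of_all _ fun k => hinc M x u k)
        _ = _ := by rw [← Finset.sum_mul, PMF.sum_toReal_eq_one, one_mul]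
    · simp_rw [hstep]
      refine tendsto_finsetSum _ fun u _ => Tendsto.const_mul _ ?_
      have hval : ((min x (u : ℕ) : ℕ) : ℝ) - ∫ k, (k : ℝ) ∂y =
          ∫ k : ℕ, (((min x (u : ℕ) : ℕ) : ℝ) - k) ∂y := by
        rw [integral_sub (integrable_const _) hy]; simp
      rw [hval]
      refine tendsto_integral_of_dominated_convergence (fun k : ℕ => (C : ℝ) + k)
        (fun _ => Measurable.of_discrete.aestronglyMeasurable) hbi
        (fun M => ae_of_all _ fun k => hinc M x u k) (ae_of_all _ fun k => ?_)
      refine tendsto_const_nhds.congr' ?_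
      filter_upwards [eventually_ge_atTop (x + k)] with M hM
      have h1 : min (x - (u : ℕ) + k) M + min x u = min x M + k := by omega
      have h1' : ((min (x - (u : ℕ) + k) M : ℕ) : ℝ) + (min x (u : ℕ) : ℕ) = (min x M : ℕ) + k := by
        exact_mod_cast h1
      simp only [hf]
      linarith
  simp_rw [hzero] at hlim
  exact (tendsto_nhds_unique hlim tendsto_const_nhds)

/-- In a stable queue fewer passengers arrive, on average, than there are spaces available: the mean
number that board is the mean of `Y`, and the vehicles that find no queue leave spaces empty. -/
theorem integral_lt_meanSpace_of_isStableQueue [IsProbabilityMeasure y]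
    (hs : ∀ u, Tendsto (fun l => s l u) atTop (𝓝 (s_lim u))) (hpos : 0 < meanSpace s_lim)
    (hy : Integrable (fun k : ℕ => (k : ℝ)) y) (hy0 : 0 < y.real {0}) (h : IsStableQueue s y) :
    ∫ k, (k : ℝ) ∂y < meanSpace s_lim := by
  obtain ⟨q, hqp, hq⟩ := h
  have hst := fun (f : ℕ → ℝ) (N : ℕ) (hf : ∀ x, N ≤ x → f x = 0) =>
    integral_queueStep_eq_of_tendsto hs (hq (Measure.dirac 0) inferInstance) hf
  have hq0 := real_singleton_zero_pos_of_stationary hy0 hpos hst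
  have hdrift := integral_drift_eq_zero_of_stationary hy hst
  set m := ∫ k, (k : ℝ) ∂y with hm
  have hm0 : 0 ≤ m := integral_nonneg fun k => by positivity
  have hsum : ∀ x : ℕ, ∑ u : Fin (C + 1), (s_lim u).toReal * (((min x (u : ℕ) : ℕ) : ℝ) - m) =
      (∑ u : Fin (C + 1), (s_lim u).toReal * ((min x (u : ℕ) : ℕ) : ℝ)) - m := fun x => by
    simp_rw [mul_sub, Finset.sum_sub_distrib, ← Finset.sum_mul, PMF.sum_toReal_eq_one, one_mul]
  have hmin : ∀ x : ℕ, ∑ u : Fin (C + 1), (s_lim u).toReal * ((min x (u : ℕ) : ℕ) : ℝ) ≤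
      meanSpace s_lim := fun x => Finset.sum_le_sum fun u _ => by
    rw [mul_comm]
    gcongr
    exact min_le_right _ _
  have hmin0 : ∀ x : ℕ, 0 ≤ ∑ u : Fin (C + 1), (s_lim u).toReal * ((min x (u : ℕ) : ℕ) : ℝ) :=
    fun x => Finset.sum_nonneg fun u _ => by positivity
  have hle : 0 ≤ (meanSpace s_lim - m) - q.real {0} * meanSpace s_lim := by
    calc (0 : ℝ) = _ := hdrift.symm
      _ ≤ ∫ x : ℕ, ((meanSpace s_lim - m) -
          Set.indicator {0} (fun _ => meanSpace s_lim) x) ∂q := by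
        refine integral_mono (integrable_of_abs_le (c := meanSpace s_lim + m) fun x => ?_)
          (integrable_of_abs_le (c := 2 * meanSpace s_lim + m) fun x => ?_) fun x => ?_
        · have := hmin x
          have := hmin0 x
          rw [hsum, abs_le]; constructor <;> linarith
        · by_cases hx : x = 0
          · simp only [hx, Set.mem_singleton_iff, Set.indicator_of_mem]
            rw [abs_le]; constructor <;> linarith
          · simp only [Set.mem_singleton_iff, hx, not_false_eq_true, Set.indicator_of_notMem]
            rw [abs_le]; constructor <;> linarith
        · dsimp only
          rw [hsum]
          by_cases hx : x = 0
          · simp [hx]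
          · simpa [hx] using hmin x
      _ = _ := by
        rw [integral_sub (integrable_const _)
          ((integrable_const _).indicator (measurableSet_singleton _)),
          integral_indicator_const _ (measurableSet_singleton _)]
        simp
  have := mul_pos hq0 hpos
  linarith

end Necessity

/-! ### Exponential contraction of the transition operator -/

section Contraction

variable {C : ℕ} {s : ℕ → PMF (Fin (C + 1))} {p : PMF (Fin (C + 1))} {y q₁ : Measure ℕ} {t : ℝ}

/-- The moment generating function of `Y - S` at `t`, for independent `S` with law `p` and `Y` with
law `y`. -/
noncomputable def netArrivalMGF (p : PMF (Fin (C + 1))) (y : Measure ℕ) (t : ℝ) : ℝ :=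
  (∑ u : Fin (C + 1), (p u).toReal * Real.exp (-(t * (u : ℕ)))) * ∫ k : ℕ, Real.exp (t * k) ∂y

theorem netArrivalMGF_nonneg : 0 ≤ netArrivalMGF p y t :=
  mul_nonneg (Finset.sum_nonneg fun _ _ => by positivity)
    (integral_nonneg fun _ => (Real.exp_pos _).le)

/-- Exponential contraction. In the coupling of two queues of lengths `x < z` with the same `S` and
`Y`, either the queues merge, or `S < z` and the longer one becomes `z - S + Y` exactly, without
truncation. Hence differences weighted by `exp (t * z)` shrink by the factor `E exp (t * (Y - S))`. -/
theorem abs_queueStep_sub_le [IsProbabilityMeasure y]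
    (hy : Integrable (fun k : ℕ => Real.exp (t * k)) y) {f : ℕ → ℝ} {a c : ℝ} (hc : 0 ≤ c)
    (hfa : ∀ x, |f x| ≤ a) (hf : ∀ x z, x < z → |f x - f z| ≤ c * Real.exp (t * z))
    {x z : ℕ} (hxz : x < z) :
    |queueStep p y f x - queueStep p y f z| ≤ c * netArrivalMGF p y t * Real.exp (t * z) := by
  have hpt : ∀ (u : Fin (C + 1)) (k : ℕ), |f (x - (u : ℕ) + k) - f (z - (u : ℕ) + k)| ≤
      c * Real.exp (t * z) * Real.exp (-(t * (u : ℕ))) * Real.exp (t * k) := by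
    intro u k
    by_cases hu : (u : ℕ) < z
    · refine (hf _ _ (by omega)).trans (le_of_eq ?_)
      rw [mul_assoc, mul_assoc, ← Real.exp_add, ← Real.exp_add]
      push_cast [hu.le]
      ring_nf
    · rw [Nat.sub_eq_zero_of_le (not_lt.1 hu), Nat.sub_eq_zero_of_le (by omega), sub_self, abs_zero]
      positivity
  have hint : ∀ w (u : Fin (C + 1)), Integrable (fun k => f (w - (u : ℕ) + k)) y := fun w u =>
    integrable_of_abs_le fun k => hfa _
  simp only [queueStep, ← Finset.sum_sub_distrib, ← mul_sub]
  calc _ ≤ ∑ u : Fin (C + 1), |(p u).toReal *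
        ((∫ k, f (x - (u : ℕ) + k) ∂y) - ∫ k, f (z - (u : ℕ) + k) ∂y)| :=
        Finset.abs_sum_le_sum_abs _ _
    _ ≤ ∑ u : Fin (C + 1), (p u).toReal *
        (c * Real.exp (t * z) * Real.exp (-(t * (u : ℕ))) * ∫ k : ℕ, Real.exp (t * k) ∂y) := by
        refine Finset.sum_le_sum fun u _ => ?_
        rw [abs_mul, abs_of_nonneg ENNReal.toReal_nonneg, ← integral_sub (hint x u) (hint z u),
          ← integral_const_mul]
        refine mul_le_mul_of_nonneg_left ?_ ENNReal.toReal_nonneg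
        exact norm_integral_le_of_norm_le
          (f := fun k => f (x - (u : ℕ) + k) - f (z - (u : ℕ) + k)) (hy.const_mul _)
          (ae_of_all _ fun k => hpt u k)
    _ = _ := by
        simp only [netArrivalMGF, Finset.sum_mul, Finset.mul_sum]
        exact Finset.sum_congr rfl fun u _ => by ring

theorem abs_iterate_queueStep_le [IsProbabilityMeasure y] {f : ℕ → ℝ} {a : ℝ}
    (hf : ∀ x, |f x| ≤ a) (m : ℕ) : ∀ x, |(queueStep p y)^[m] f x| ≤ a := by
  induction m with
  | zero => simpa using hf
  | succ m ih =>
    intro x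
    rw [Function.iterate_succ_apply']
    exact abs_queueStep_le ih x

/-- The contraction iterated; a function bounded by one has oscillation at most two, and the weight
`exp (t * z)` is at least one. -/
theorem abs_iterate_queueStep_sub_le [IsProbabilityMeasure y] (ht : 0 ≤ t)
    (hy : Integrable (fun k : ℕ => Real.exp (t * k)) y) {f : ℕ → ℝ} (hf : ∀ x, |f x| ≤ 1) (m : ℕ) :
    ∀ x z, x < z → |(queueStep p y)^[m] f x - (queueStep p y)^[m] f z| ≤
      2 * netArrivalMGF p y t ^ m * Real.exp (t * z) := by
  induction m with
  | zero =>
    intro x z _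
    have h1 : (1 : ℝ) ≤ Real.exp (t * z) := Real.one_le_exp (by positivity)
    have h2 := abs_le.1 (hf x)
    have h3 := abs_le.1 (hf z)
    simp only [Function.iterate_zero, id_eq, pow_zero, mul_one]
    rw [abs_le]
    constructor <;> linarith [h2.1, h2.2, h3.1, h3.2]
  | succ m ih =>
    intro x z hxz
    rw [Function.iterate_succ_apply', pow_succ, ← mul_assoc]
    exact abs_queueStep_sub_le hy (mul_nonneg zero_le_two (pow_nonneg netArrivalMGF_nonneg m))
      (abs_iterate_queueStep_le hf m) ih hxz

/-- Iterates of the transition operator, evaluated at the empty queue, converge geometrically, at a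
rate that is uniform over test functions bounded by one. -/
theorem exists_abs_iterate_queueStep_sub_le [IsProbabilityMeasure y] (ht : 0 ≤ t)
    (hy : Integrable (fun k : ℕ => Real.exp (t * k)) y) (hb : netArrivalMGF p y t < 1)
    {f : ℕ → ℝ} (hf : ∀ x, |f x| ≤ 1) :
    ∃ a : ℝ, ∀ m, |(queueStep p y)^[m] f 0 - a| ≤
      2 * (∫ k : ℕ, Real.exp (t * k) ∂y) * netArrivalMGF p y t ^ m / (1 - netArrivalMGF p y t) := by
  set b := netArrivalMGF p y t with hbdef
  have hb0 : 0 ≤ b := netArrivalMGF_nonneg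
  have hstep : ∀ m, dist ((queueStep p y)^[m] f 0) ((queueStep p y)^[m + 1] f 0) ≤
      2 * (∫ k : ℕ, Real.exp (t * k) ∂y) * b ^ m := by
    intro m
    set g := (queueStep p y)^[m] f with hg
    have hg1 : ∀ x, |g x| ≤ 1 := abs_iterate_queueStep_le hf m
    have hgk : ∀ k : ℕ, |g k - g 0| ≤ 2 * b ^ m * Real.exp (t * k) := by
      intro k
      rcases Nat.eq_zero_or_pos k with rfl | hk
      · rw [sub_self, abs_zero]; positivity
      · rw [abs_sub_comm]
        exact abs_iterate_queueStep_sub_le ht hy hf m 0 k hk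
    rw [Function.iterate_succ_apply', ← hg, dist_comm, Real.dist_eq]
    have h0 : queueStep p y g 0 = ∫ k, g k ∂y := by
      simp [queueStep, ← Finset.sum_mul, PMF.sum_toReal_eq_one]
    have h1 : queueStep p y g 0 - g 0 = ∫ k, (g k - g 0) ∂y := by
      rw [integral_sub (integrable_of_abs_le hg1) (integrable_const _), h0]
      simp
    rw [h1]
    calc _ ≤ ∫ k : ℕ, 2 * b ^ m * Real.exp (t * k) ∂y :=
          norm_integral_le_of_norm_le (f := fun k => g k - g 0) (hy.const_mul _)
            (ae_of_all _ hgk)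
      _ = _ := by rw [integral_const_mul]; ring
  obtain ⟨a, ha⟩ := cauchySeq_tendsto_of_complete (cauchySeq_of_le_geometric _ _ hb hstep)
  exact ⟨a, fun m => dist_le_of_le_geometric_of_tendsto _ _ hb hstep ha m⟩

theorem integral_queueLaw_const [IsProbabilityMeasure y] [IsProbabilityMeasure q₁] (m : ℕ) :
    ∀ {f : ℕ → ℝ} {a : ℝ}, (∀ x, |f x| ≤ a) →
      ∫ x, f x ∂(queueLaw (fun _ => p) y q₁ m) = ∫ x, (queueStep p y)^[m] f x ∂q₁ := by
  induction m with
  | zero => intro f a _; rfl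
  | succ m ih =>
    intro f a hf
    have := isProbabilityMeasure_queueLaw (s := fun _ => p) (y := y) (q₁ := q₁) (m + 1)
    rw [integral_queueLaw_succ (integrable_of_abs_le hf), ih (abs_queueStep_le hf)]
    rfl

/-! ### The steady state of the limiting queue -/

/-- The steady state of the queue with constant law `p` of the available space, and the geometric
speed of convergence to it from an initial queue of length `x`. The uniform rate of
`exists_abs_iterate_queueStep_sub_le` prevents the limit from losing mass. -/
theorem exists_stationary_abs_iterate_sub_le [IsProbabilityMeasure y] (ht : 0 ≤ t)
    (hy : Integrable (fun k : ℕ => Real.exp (t * k)) y) (hb : netArrivalMGF p y t < 1) :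
    ∃ q : Measure ℕ, IsProbabilityMeasure q ∧ ∃ K : ℝ, 0 ≤ K ∧ ∀ k m x : ℕ,
      |(queueStep p y)^[m] (Set.indicator {k} 1) x - q.real {k}| ≤
        K * netArrivalMGF p y t ^ m * Real.exp (t * x) := by
  set b := netArrivalMGF p y t with hbdef
  have hb0 : 0 ≤ b := netArrivalMGF_nonneg
  have hb1 : 0 < 1 - b := by linarith
  set M := ∫ k : ℕ, Real.exp (t * k) ∂y with hM
  have hM0 : 0 ≤ M := integral_nonneg fun _ => (Real.exp_pos _).le
  have hind : ∀ (A : Set ℕ) (x : ℕ), |Set.indicator A (1 : ℕ → ℝ) x| ≤ 1 := fun A x => by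
    by_cases hx : x ∈ A <;> simp [hx]
  choose a ha using fun A : Set ℕ =>
    exists_abs_iterate_queueStep_sub_le (p := p) ht hy hb (hind A)
  set ν : ℕ → Measure ℕ := queueLaw (fun _ => p) y (Measure.dirac 0) with hν
  have hνp : ∀ m, IsProbabilityMeasure (ν m) := fun m => isProbabilityMeasure_queueLaw m
  have hνA : ∀ m (A : Set ℕ),
      (queueStep p y)^[m] (Set.indicator A 1) 0 = (ν m).real A := fun m A => by
    rw [← integral_indicator_one (Set.to_countable A).measurableSet,
      integral_queueLaw_const m (hind A), integral_dirac]
  simp_rw [hνA] at ha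
  have hpow : Tendsto (fun m => 2 * M * b ^ m / (1 - b)) atTop (𝓝 0) := by
    simpa using ((tendsto_pow_atTop_nhds_zero_of_lt_one hb0 hb).const_mul (2 * M)).div_const (1 - b)
  have hlim : ∀ A, Tendsto (fun m => (ν m).real A) atTop (𝓝 (a A)) := fun A =>
    tendsto_iff_dist_tendsto_zero.2
      (squeeze_zero (fun _ => dist_nonneg) (fun m => ha A m) hpow)
  have ha0 : ∀ A, 0 ≤ a A := fun A => ge_of_tendsto' (hlim A) fun _ => measureReal_nonneg
  have hfin : ∀ (ρ : Measure ℕ) [IsProbabilityMeasure ρ] (N : ℕ),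
      ρ.real (Set.Iio N) = ∑ k ∈ Finset.range N, ρ.real {k} := by
    intro ρ _ N
    rw [← integral_indicator_one (Set.to_countable _).measurableSet,
      integral_eq_sum_range_of_eq_zero ρ (N := N) fun x hx => by simp [hx]]
    exact Finset.sum_congr rfl fun k hk => by simp [Finset.mem_range.1 hk]
  have hsum : ∀ N, ∑ k ∈ Finset.range N, a {k} = a (Set.Iio N) := fun N =>
    tendsto_nhds_unique (tendsto_finsetSum _ fun k _ => hlim {k})
      ((hlim (Set.Iio N)).congr fun m => hfin (ν m) N)
  have hone : HasSum (fun k : ℕ => a {k}) 1 := by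
    rw [hasSum_iff_tendsto_nat_of_nonneg fun k => ha0 _]
    simp_rw [hsum]
    rw [Metric.tendsto_atTop]
    intro ε hε
    obtain ⟨m, hm⟩ := (hpow.eventually (gt_mem_nhds (half_pos hε))).exists
    have hmass : Tendsto (fun N => (ν m).real (Set.Iio N)) atTop (𝓝 1) := by
      have h := tendsto_measure_iUnion_atTop (μ := ν m) (s := fun N : ℕ => Set.Iio N)
        fun i j hij => Set.Iio_subset_Iio hij
      have hU : ⋃ N : ℕ, Set.Iio N = Set.univ :=
        Set.eq_univ_of_forall fun x => Set.mem_iUnion.2 ⟨x + 1, by simp⟩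
      rw [hU, measure_univ] at h
      exact (ENNReal.tendsto_toReal ENNReal.one_ne_top).comp h
    obtain ⟨N₀, hN₀⟩ := Metric.tendsto_atTop.1 hmass (ε / 2) (half_pos hε)
    refine ⟨N₀, fun N hN => ?_⟩
    have h1 := (ha (Set.Iio N) m).trans_lt hm
    have h2 := hN₀ N hN
    calc dist (a (Set.Iio N)) 1 ≤ dist (a (Set.Iio N)) ((ν m).real (Set.Iio N)) +
          dist ((ν m).real (Set.Iio N)) 1 := dist_triangle _ _ _
      _ < ε / 2 + ε / 2 := by
        refine add_lt_add ?_ h2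
        rw [dist_comm, Real.dist_eq]
        exact h1
      _ = ε := add_halves ε
  let q : PMF ℕ := ⟨fun k => ENNReal.ofReal (a {k}), by
    have h : ∑' k, ENNReal.ofReal (a {k}) = 1 := by
      rw [← ENNReal.ofReal_tsum_of_nonneg (fun k => ha0 _) hone.summable, hone.tsum_eq,
        ENNReal.ofReal_one]
    exact h ▸ ENNReal.summable.hasSum⟩
  have hqk : ∀ k, q.toMeasure.real {k} = a {k} := fun k => by
    rw [measureReal_def, PMF.toMeasure_apply_singleton _ _ (measurableSet_singleton _)]
    exact ENNReal.toReal_ofReal (ha0 _)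
  refine ⟨q.toMeasure, inferInstance, 2 + 2 * M / (1 - b), by positivity, fun k m x => ?_⟩
  rw [hqk]
  have hx1 : (1 : ℝ) ≤ Real.exp (t * x) := Real.one_le_exp (by positivity)
  have hosc : |(queueStep p y)^[m] (Set.indicator {k} 1) x -
      (queueStep p y)^[m] (Set.indicator {k} 1) 0| ≤ 2 * b ^ m * Real.exp (t * x) := by
    rcases Nat.eq_zero_or_pos x with rfl | hx
    · rw [sub_self, abs_zero]; positivity
    · rw [abs_sub_comm]
      exact abs_iterate_queueStep_sub_le ht hy (hind _) m 0 x hx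
  rw [hνA] at hosc
  have h2 : 2 * M * b ^ m / (1 - b) ≤ 2 * M / (1 - b) * b ^ m * Real.exp (t * x) := by
    have : 2 * M * b ^ m / (1 - b) = 2 * M / (1 - b) * b ^ m := by ring
    rw [this]
    exact le_mul_of_one_le_right (by positivity) hx1
  calc _ ≤ |(queueStep p y)^[m] (Set.indicator {k} 1) x - (ν m).real {k}| +
        |(ν m).real {k} - a {k}| := abs_sub_le _ _ _
    _ ≤ 2 * b ^ m * Real.exp (t * x) + 2 * M / (1 - b) * b ^ m * Real.exp (t * x) :=
      add_le_add hosc ((ha {k} m).trans h2)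
    _ = _ := by ring

/-! ### Convergence of the time-dependent queue -/

/-- After a late time, finitely many steps of the time-dependent queue are close to steps of the
limiting queue. -/
theorem tendsto_integral_queueLaw_add_sub [IsProbabilityMeasure y] [IsProbabilityMeasure q₁]
    (hs : ∀ u, Tendsto (fun l => s l u) atTop (𝓝 (p u))) (m : ℕ) :
    ∀ {f : ℕ → ℝ} {a : ℝ}, (∀ x, |f x| ≤ a) →
      Tendsto (fun l => (∫ x, f x ∂(queueLaw s y q₁ (l + m))) -
        ∫ x, (queueStep p y)^[m] f x ∂(queueLaw s y q₁ l)) atTop (𝓝 0) := by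
  have hpr := fun l => isProbabilityMeasure_queueLaw (s := s) (y := y) (q₁ := q₁) l
  induction m with
  | zero => intro f a _; simp
  | succ m ih =>
    intro f a hf
    have h1 := ih (abs_queueStep_le (p := p) (y := y) hf)
    have hdiff : ∀ j x, |queueStep (s j) y f x - queueStep p y f x| ≤
        ∑ u : Fin (C + 1), |(s j u).toReal - (p u).toReal| * a := by
      intro j x
      simp only [queueStep, ← Finset.sum_sub_distrib, ← sub_mul]
      refine (Finset.abs_sum_le_sum_abs _ _).trans (Finset.sum_le_sum fun u _ => ?_)
      rw [abs_mul]
      exact mul_le_mul_of_nonneg_left (abs_integral_le_of_abs_le fun k => hf _) (abs_nonneg _)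
    have hzero : Tendsto (fun j => ∑ u : Fin (C + 1), |(s j u).toReal - (p u).toReal| * a) atTop
        (𝓝 0) := by
      have : Tendsto (fun j => ∑ u : Fin (C + 1), |(s j u).toReal - (p u).toReal| * a) atTop
          (𝓝 (∑ u : Fin (C + 1), |(p u).toReal - (p u).toReal| * a)) :=
        tendsto_finsetSum _ fun u _ =>
          (((tendsto_toReal_apply hs u).sub_const _).abs).mul_const a
      simpa using this
    have h2 : Tendsto (fun l => ∫ x, (queueStep (s (l + m)) y f x - queueStep p y f x)
        ∂(queueLaw s y q₁ (l + m))) atTop (𝓝 0) :=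
      squeeze_zero_norm (fun l => abs_integral_le_of_abs_le (hdiff (l + m)))
        (hzero.comp (tendsto_add_atTop_nat m))
    have h3 := h2.add h1
    rw [add_zero] at h3
    refine h3.congr fun l => ?_
    rw [← add_assoc, integral_queueLaw_succ (integrable_of_abs_le hf),
      integral_sub (integrable_of_abs_le fun x => abs_queueStep_le hf x)
        (integrable_of_abs_le fun x => abs_queueStep_le hf x), Function.iterate_succ_apply]
    ring

theorem integrable_exp_queueLaw [IsProbabilityMeasure y] [IsProbabilityMeasure q₁] (ht : 0 ≤ t)
    (hy : Integrable (fun k : ℕ => Real.exp (t * k)) y)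
    (hq : Integrable (fun k : ℕ => Real.exp (t * k)) q₁) (l : ℕ) :
    Integrable (fun k : ℕ => Real.exp (t * k)) (queueLaw s y q₁ l) := by
  induction l with
  | zero => exact hq
  | succ l ih =>
    have := isProbabilityMeasure_queueLaw (s := s) (y := y) (q₁ := q₁) l
    rw [queueLaw, integrable_map_measure Measurable.of_discrete.aestronglyMeasurable
      Measurable.of_discrete.aemeasurable]
    have h1 : Integrable (fun _ : Fin (C + 1) => (1 : ℝ)) (s l).toMeasure := integrable_const _
    refine (ih.mul_prod (h1.mul_prod hy)).mono' Measurable.of_discrete.aestronglyMeasurable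
      (ae_of_all _ fun w => ?_)
    rw [Function.comp_apply, Real.norm_eq_abs, abs_of_pos (Real.exp_pos _), one_mul,
      ← Real.exp_add, ← mul_add]
    refine Real.exp_le_exp.2 (mul_le_mul_of_nonneg_left ?_ ht)
    have : w.1 - (w.2.1 : ℕ) + w.2.2 ≤ w.1 + w.2.2 := by omega
    exact_mod_cast this

/-- Foster–Lyapunov drift: the exponential moments of the queue length remain bounded. -/
theorem exists_eventually_integral_exp_le [IsProbabilityMeasure y] [IsProbabilityMeasure q₁]
    (ht : 0 ≤ t) (hy : Integrable (fun k : ℕ => Real.exp (t * k)) y)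
    (hq : Integrable (fun k : ℕ => Real.exp (t * k)) q₁)
    (hs : ∀ u, Tendsto (fun l => s l u) atTop (𝓝 (p u))) (hb : netArrivalMGF p y t < 1) :
    ∃ B : ℝ, ∀ᶠ l in atTop, ∫ x : ℕ, Real.exp (t * x) ∂(queueLaw s y q₁ l) ≤ B := by
  set M := ∫ k : ℕ, Real.exp (t * k) ∂y with hM
  have hM0 : 0 ≤ M := integral_nonneg fun _ => (Real.exp_pos _).le
  set E : ℕ → ℝ := fun l => ∫ x : ℕ, Real.exp (t * x) ∂(queueLaw s y q₁ l) with hE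
  have hE0 : ∀ l, 0 ≤ E l := fun l => integral_nonneg fun _ => (Real.exp_pos _).le
  have hstep : ∀ l (x : ℕ), queueStep (s l) y (fun k : ℕ => Real.exp (t * k)) x ≤
      netArrivalMGF (s l) y t * Real.exp (t * x) + M := by
    intro l x
    calc _ ≤ ∑ u : Fin (C + 1), (s l u).toReal *
          ((Real.exp (t * x) * Real.exp (-(t * (u : ℕ))) + 1) * M) := by
          refine Finset.sum_le_sum fun u _ => mul_le_mul_of_nonneg_left ?_ ENNReal.toReal_nonneg
          have hk : ∀ k : ℕ, Real.exp (t * ((x - (u : ℕ) + k : ℕ) : ℝ)) =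
              Real.exp (t * ((x - (u : ℕ) : ℕ) : ℝ)) * Real.exp (t * k) := fun k => by
            rw [← Real.exp_add]; push_cast; ring_nf
          simp_rw [hk]
          rw [integral_const_mul]
          refine mul_le_mul_of_nonneg_right ?_ hM0
          by_cases hu : (u : ℕ) ≤ x
          · rw [← Real.exp_add]
            push_cast [hu]
            have : t * ((x : ℝ) - (u : ℕ)) = t * x + -(t * (u : ℕ)) := by ring
            rw [this]
            linarith
          · rw [Nat.sub_eq_zero_of_le (by omega)]
            simp only [Nat.cast_zero, mul_zero, Real.exp_zero]
            linarith [mul_pos (Real.exp_pos (t * x)) (Real.exp_pos (-(t * (u : ℕ))))]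
      _ = netArrivalMGF (s l) y t * Real.exp (t * x) + (∑ u, (s l u).toReal) * M := by
          simp only [netArrivalMGF, Finset.sum_mul, ← Finset.sum_add_distrib]
          exact Finset.sum_congr rfl fun u _ => by ring
      _ = _ := by rw [PMF.sum_toReal_eq_one, one_mul]
  have hrec : ∀ l, E (l + 1) ≤ netArrivalMGF (s l) y t * E l + M := by
    intro l
    have := isProbabilityMeasure_queueLaw (s := s) (y := y) (q₁ := q₁) l
    have hil := integrable_exp_queueLaw (s := s) ht hy hq l
    have hub : Integrable (fun x : ℕ => netArrivalMGF (s l) y t * Real.exp (t * x) + M)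
        (queueLaw s y q₁ l) := (hil.const_mul _).add (integrable_const _)
    calc E (l + 1) = ∫ x, queueStep (s l) y (fun k : ℕ => Real.exp (t * k)) x
          ∂(queueLaw s y q₁ l) := integral_queueLaw_succ (integrable_exp_queueLaw ht hy hq (l + 1))
      _ ≤ ∫ x : ℕ, (netArrivalMGF (s l) y t * Real.exp (t * x) + M) ∂(queueLaw s y q₁ l) :=
        integral_mono_of_nonneg (ae_of_all _ fun x => Finset.sum_nonneg fun u _ =>
          mul_nonneg ENNReal.toReal_nonneg (integral_nonneg fun _ => (Real.exp_pos _).le)) hub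
          (ae_of_all _ (hstep l))
      _ = _ := by
        rw [integral_add (hil.const_mul _) (integrable_const _), integral_const_mul]
        simp [hE]
  obtain ⟨β, hβ, hβ1⟩ := exists_between hb
  have hbl : Tendsto (fun l => netArrivalMGF (s l) y t) atTop (𝓝 (netArrivalMGF p y t)) :=
    (tendsto_finsetSum _ fun u _ => (tendsto_toReal_apply hs u).mul_const _).mul_const _
  obtain ⟨L, hL⟩ := eventually_atTop.1 (hbl.eventually (gt_mem_nhds hβ))
  have h1β : 0 < 1 - β := by linarith
  have hβ0 : 0 ≤ β := netArrivalMGF_nonneg.trans hβ.le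
  refine ⟨max (E L) (M / (1 - β)), eventually_atTop.2 ⟨L, fun l hl => ?_⟩⟩
  induction l, hl using Nat.le_induction with
  | base => exact le_max_left _ _
  | succ l hl ih =>
    set B := max (E L) (M / (1 - β)) with hB
    have hMB : M ≤ (1 - β) * B := by
      have := (div_le_iff₀ h1β).1 (le_max_right (E L) (M / (1 - β)))
      linarith
    calc E (l + 1) ≤ netArrivalMGF (s l) y t * E l + M := hrec l
      _ ≤ β * B + (1 - β) * B := by
        refine add_le_add ?_ hMB
        exact mul_le_mul (hL l hl).le ih (hE0 l) hβ0
      _ = B := by ring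

/-- The law of the queue length is a mixture over the initial queue length. -/
theorem integral_queueLaw_eq_integral_dirac [IsProbabilityMeasure y] [IsProbabilityMeasure q₁]
    (l : ℕ) : ∀ {f : ℕ → ℝ} {a : ℝ}, (∀ x, |f x| ≤ a) →
      ∫ x, f x ∂(queueLaw s y q₁ l) =
        ∫ x, (∫ z, f z ∂(queueLaw s y (Measure.dirac x) l)) ∂q₁ := by
  induction l with
  | zero => intro f a _; simp [queueLaw]
  | succ l ih =>
    intro f a hf
    have hpr : ∀ (q₀ : Measure ℕ) [IsProbabilityMeasure q₀],
        IsProbabilityMeasure (queueLaw s y q₀ (l + 1)) :=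
      fun q₀ _ => isProbabilityMeasure_queueLaw (l + 1)
    have := hpr q₁
    rw [integral_queueLaw_succ (integrable_of_abs_le hf), ih (abs_queueStep_le hf)]
    refine integral_congr_ae (ae_of_all _ fun x => ?_)
    have := hpr (Measure.dirac x)
    exact (integral_queueLaw_succ (integrable_of_abs_le hf)).symm

theorem isStableQueue_of_netArrivalMGF_lt_one [IsProbabilityMeasure y] (ht : 0 ≤ t)
    (hy : Integrable (fun k : ℕ => Real.exp (t * k)) y)
    (hs : ∀ u, Tendsto (fun l => s l u) atTop (𝓝 (p u))) (hb : netArrivalMGF p y t < 1) :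
    IsStableQueue s y := by
  obtain ⟨q, hq, K, hK, hqK⟩ := exists_stationary_abs_iterate_sub_le (p := p) ht hy hb
  refine ⟨q, hq, fun q₁ hq₁ k => ?_⟩
  set f : ℕ → ℝ := Set.indicator {k} 1 with hf
  have hf1 : ∀ x, |f x| ≤ 1 := fun x => by by_cases hx : x = k <;> simp [hf, hx]
  have hreal : ∀ ρ : Measure ℕ, ∫ x, f x ∂ρ = ρ.real {k} := fun ρ =>
    integral_indicator_one (measurableSet_singleton k)
  have hpr : ∀ (q₀ : Measure ℕ) [IsProbabilityMeasure q₀] l,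
      IsProbabilityMeasure (queueLaw s y q₀ l) := fun q₀ _ l => isProbabilityMeasure_queueLaw l
  -- An arbitrary initial law need not have exponential moments, a deterministic start has them.
  have hdirac : ∀ x, Tendsto (fun l => ∫ z, f z ∂(queueLaw s y (Measure.dirac x) l)) atTop
      (𝓝 (q.real {k})) := by
    intro x
    have hqx : Integrable (fun j : ℕ => Real.exp (t * j)) (Measure.dirac x) :=
      integrable_dirac (by simp)
    obtain ⟨B, hBl⟩ := exists_eventually_integral_exp_le ht hy hqx hs hb
    rw [Metric.tendsto_atTop]
    intro ε hε
    have hpow : Tendsto (fun m => K * netArrivalMGF p y t ^ m * B) atTop (𝓝 0) := by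
      simpa using ((tendsto_pow_atTop_nhds_zero_of_lt_one netArrivalMGF_nonneg hb).const_mul
        K).mul_const B
    obtain ⟨m, hm⟩ := (hpow.eventually (gt_mem_nhds (half_pos hε))).exists
    have h1 := (tendsto_integral_queueLaw_add_sub (q₁ := Measure.dirac x) (y := y) hs m
      hf1).eventually (Metric.ball_mem_nhds 0 (half_pos hε))
    obtain ⟨L, hL⟩ := eventually_atTop.1 (h1.and hBl)
    refine ⟨L + m, fun l hl => ?_⟩
    obtain ⟨j, rfl⟩ : ∃ j, l = j + m := ⟨l - m, by omega⟩
    obtain ⟨h2, h3⟩ := hL j (by omega)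
    rw [dist_zero_right, Real.norm_eq_abs] at h2
    have := hpr (Measure.dirac x) j
    have h4 : |(∫ z, (queueStep p y)^[m] f z ∂(queueLaw s y (Measure.dirac x) j)) - q.real {k}| ≤
        K * netArrivalMGF p y t ^ m * B := by
      have h5 : (∫ z, (queueStep p y)^[m] f z ∂(queueLaw s y (Measure.dirac x) j)) - q.real {k} =
          ∫ z, ((queueStep p y)^[m] f z - q.real {k}) ∂(queueLaw s y (Measure.dirac x) j) := by
        rw [integral_sub (integrable_of_abs_le (abs_iterate_queueStep_le hf1 m))
          (integrable_const _)]
        simp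
      rw [h5]
      calc _ ≤ ∫ z : ℕ, K * netArrivalMGF p y t ^ m * Real.exp (t * z)
            ∂(queueLaw s y (Measure.dirac x) j) :=
            norm_integral_le_of_norm_le
              (f := fun z => (queueStep p y)^[m] f z - q.real {k})
              ((integrable_exp_queueLaw ht hy hqx j).const_mul _)
              (ae_of_all _ fun z => hqK k m z)
        _ ≤ _ := by
            rw [integral_const_mul]
            exact mul_le_mul_of_nonneg_left h3
              (mul_nonneg hK (pow_nonneg netArrivalMGF_nonneg m))
    rw [Real.dist_eq]
    calc _ ≤ _ := abs_sub_le _ (∫ z, (queueStep p y)^[m] f z ∂(queueLaw s y (Measure.dirac x) j)) _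
      _ < ε / 2 + ε / 2 := add_lt_add h2 (h4.trans_lt hm)
      _ = ε := add_halves ε
  have hmix : Tendsto (fun l => ∫ x, (∫ z, f z ∂(queueLaw s y (Measure.dirac x) l)) ∂q₁) atTop
      (𝓝 (∫ _, q.real {k} ∂q₁)) := by
    refine tendsto_integral_of_dominated_convergence (fun _ => (1 : ℝ))
      (fun _ => Measurable.of_discrete.aestronglyMeasurable) (integrable_const _)
      (fun l => ae_of_all _ fun x => ?_) (ae_of_all _ hdirac)
    have := hpr (Measure.dirac x) l
    exact abs_integral_le_of_abs_le hf1
  rw [integral_const, probReal_univ, one_smul] at hmix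
  refine hmix.congr fun l => ?_
  rw [← integral_queueLaw_eq_integral_dirac l hf1, hreal]

/-- The function `netArrivalMGF p y` has value one and derivative `E Y - E S` at zero. -/
theorem exists_netArrivalMGF_lt_one [IsProbabilityMeasure y]
    (hy : ∀ t : ℝ, Integrable (fun k : ℕ => Real.exp (t * k)) y)
    (hlt : ∫ k, (k : ℝ) ∂y < meanSpace p) : ∃ t, 0 < t ∧ netArrivalMGF p y t < 1 := by
  have hset : (0 : ℝ) ∈ interior (integrableExpSet (fun k : ℕ => (k : ℝ)) y) := by
    have : integrableExpSet (fun k : ℕ => (k : ℝ)) y = Set.univ := Set.eq_univ_of_forall hy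
    simp [this]
  have h1 : HasDerivAt (fun t : ℝ => ∫ k : ℕ, Real.exp (t * k) ∂y) (∫ k, (k : ℝ) ∂y) 0 := by
    have h := hasDerivAt_mgf hset
    simp only [zero_mul, Real.exp_zero, mul_one] at h
    exact h
  have h2 : HasDerivAt (fun t : ℝ => ∑ u : Fin (C + 1), (p u).toReal * Real.exp (-(t * (u : ℕ))))
      (∑ u : Fin (C + 1), (p u).toReal * (-((u : ℕ) : ℝ))) 0 := by
    refine HasDerivAt.fun_sum fun u _ => HasDerivAt.const_mul _ ?_
    simpa using (((hasDerivAt_id (0 : ℝ)).mul_const ((u : ℕ) : ℝ)).neg).exp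
  have h3 : HasDerivAt (netArrivalMGF p y) ((∫ k, (k : ℝ) ∂y) - meanSpace p) 0 := by
    convert! h2.mul h1 using 1
    simp [PMF.sum_toReal_eq_one, meanSpace, mul_comm]
    ring
  have h0 : netArrivalMGF p y 0 = 1 := by simp [netArrivalMGF, PMF.sum_toReal_eq_one]
  have h4 := (hasDerivAt_iff_tendsto_slope.1 h3).eventually (gt_mem_nhds (sub_neg.2 hlt))
  obtain ⟨t, ht, ht0⟩ := ((h4.filter_mono (nhdsGT_le_nhdsNE 0)).and self_mem_nhdsWithin).exists
  have ht0 : 0 < t := ht0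
  refine ⟨t, ht0, ?_⟩
  rw [slope_def_field, h0, sub_zero, div_neg_iff] at ht
  rcases ht with h | h <;> linarith [h.1, h.2]

/-- The stability criterion: a bulk-service queue whose arrivals have exponential moments and vanish
with positive probability is stable if and only if the mean number of arrivals is less than the mean
available space in the limit. -/
theorem isStableQueue_iff_integral_lt_meanSpace [IsProbabilityMeasure y]
    (hs : ∀ u, Tendsto (fun l => s l u) atTop (𝓝 (p u))) (hpos : 0 < meanSpace p)
    (hy1 : Integrable (fun k : ℕ => (k : ℝ)) y) (hy0 : 0 < y.real {0})
    (hy : ∀ t : ℝ, Integrable (fun k : ℕ => Real.exp (t * k)) y) :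
    IsStableQueue s y ↔ ∫ k, (k : ℝ) ∂y < meanSpace p := by
  refine ⟨integral_lt_meanSpace_of_isStableQueue hs hpos hy1 hy0, fun h => ?_⟩
  obtain ⟨t, ht, htb⟩ := exists_netArrivalMGF_lt_one hy h
  exact isStableQueue_of_netArrivalMGF_lt_one ht.le (hy t) hs htb

end Contraction

/-! ### Moments of the Poisson distribution -/

theorem lintegral_poissonMeasure (r : ℝ≥0) (f : ℕ → ℝ≥0∞) :
    ∫⁻ k, f k ∂(poissonMeasure r) =
      ∑' k : ℕ, ENNReal.ofReal (Real.exp (-r) * r ^ k / k.factorial) * f k := by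
  rw [poissonMeasure, lintegral_sum_measure]
  simp

theorem lintegral_natCast_poissonMeasure (r : ℝ≥0) :
    ∫⁻ k, ENNReal.ofReal (k : ℝ) ∂(poissonMeasure r) = r := by
  have h : HasSum (fun k : ℕ => Real.exp (-r) * r ^ k / k.factorial * (k : ℝ)) r := by
    rw [← hasSum_nat_add_iff' 1]
    convert! (hasSum_one_poissonMeasure r).mul_left (r : ℝ) using 1
    · ext k
      rw [Nat.factorial_succ]
      push_cast
      field_simp
      ring
    · simp
  rw [lintegral_poissonMeasure]
  simp_rw [← ENNReal.ofReal_mul' (Nat.cast_nonneg (α := ℝ) _)]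
  rw [← ENNReal.ofReal_tsum_of_nonneg (fun k => by positivity) h.summable, h.tsum_eq,
    ENNReal.ofReal_coe_nnreal]

/-- The exponentially tilted Poisson distribution is again Poisson, with rate `r * exp t`; this gives
its moment generating function. -/
theorem lintegral_exp_poissonMeasure (r : ℝ≥0) (t : ℝ) :
    ∫⁻ k : ℕ, ENNReal.ofReal (Real.exp (t * k)) ∂(poissonMeasure r) =
      ENNReal.ofReal (Real.exp ((Real.exp t - 1) * r)) := by
  have h : HasSum (fun k : ℕ => Real.exp (-r) * r ^ k / k.factorial * Real.exp (t * k))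
      (Real.exp ((Real.exp t - 1) * r)) := by
    convert! (hasSum_one_poissonMeasure (r * Real.toNNReal (Real.exp t))).mul_left
      (Real.exp ((Real.exp t - 1) * r)) using 1
    · ext k
      have h1 : Real.exp (-(r : ℝ)) =
          Real.exp ((Real.exp t - 1) * r) * Real.exp (-(r * Real.exp t)) := by
        rw [← Real.exp_add]; ring_nf
      have h2 : Real.exp (t * k) = Real.exp t ^ k := by rw [← Real.exp_nat_mul, mul_comm]
      rw [h1, h2, NNReal.coe_mul, Real.coe_toNNReal _ (Real.exp_pos t).le, mul_pow]
      ring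
    · rw [mul_one]
  rw [lintegral_poissonMeasure]
  simp_rw [← ENNReal.ofReal_mul' (Real.exp_pos _).le]
  rw [← ENNReal.ofReal_tsum_of_nonneg (fun k => by positivity) h.summable, h.tsum_eq]

/-! ### The mean of a normal variable truncated at zero -/

theorem integrable_mul_gaussianPDFReal : Integrable fun x : ℝ => x * gaussianPDFReal 0 1 x := by
  have h := (integrable_mul_exp_neg_mul_sq (b := 1 / 2) (by norm_num)).const_mul (√(2 * Real.pi))⁻¹
  refine h.congr (ae_of_all _ fun x => ?_)
  simp only [gaussianPDFReal_def, NNReal.coe_one, mul_one, sub_zero]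
  ring_nf

/-- The standard normal density `φ` satisfies `φ' x = -x * φ x`. -/
theorem hasDerivAt_gaussianPDFReal (x : ℝ) :
    HasDerivAt (gaussianPDFReal 0 1) (-(x * gaussianPDFReal 0 1 x)) x := by
  rw [gaussianPDFReal_def]
  have h : HasDerivAt (fun x : ℝ => -(x - 0) ^ 2 / (2 * ((1 : ℝ≥0) : ℝ))) (-x) x := by
    convert! ((((hasDerivAt_id x).sub_const 0).pow 2).neg).div_const (2 * ((1 : ℝ≥0) : ℝ)) using 1
    simp
    ring
  convert! (h.exp).const_mul (√(2 * Real.pi * ((1 : ℝ≥0) : ℝ)))⁻¹ using 1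
  ring

theorem tendsto_gaussianPDFReal_atTop : Tendsto (gaussianPDFReal 0 1) atTop (𝓝 0) := by
  rw [gaussianPDFReal_def]
  have h1 : Tendsto (fun x : ℝ => x ^ 2 / 2) atTop atTop :=
    (tendsto_pow_atTop two_ne_zero).atTop_div_const two_pos
  have h2 := (Real.tendsto_exp_neg_atTop_nhds_zero.comp h1).const_mul (√(2 * Real.pi))⁻¹
  rw [mul_zero] at h2
  refine h2.congr fun x => ?_
  simp [neg_div]

theorem setIntegral_Ioi_mul_gaussianPDFReal (a : ℝ) :
    ∫ x in Set.Ioi a, x * gaussianPDFReal 0 1 x = gaussianPDFReal 0 1 a := by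
  have h := integral_Ioi_of_hasDerivAt_of_tendsto' (a := a)
    (fun x _ => hasDerivAt_gaussianPDFReal x) integrable_mul_gaussianPDFReal.neg.integrableOn
    tendsto_gaussianPDFReal_atTop
  rw [integral_neg, zero_sub] at h
  exact neg_injective h

theorem setIntegral_Ioi_gaussianPDFReal (a : ℝ) :
    ∫ x in Set.Ioi (-a), gaussianPDFReal 0 1 x = cdf (gaussianReal 0 1) a := by
  have h := integral_comp_neg_Ioi (-a) (gaussianPDFReal 0 1)
  have heven : ∀ x, gaussianPDFReal 0 1 (-x) = gaussianPDFReal 0 1 x := fun x => by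
    simp [gaussianPDFReal_def]
  simp_rw [heven, neg_neg] at h
  rw [h, cdf_eq_real, measureReal_def, gaussianReal_apply_eq_integral _ one_ne_zero,
    ENNReal.toReal_ofReal]
  exact integral_nonneg fun x => gaussianPDFReal_nonneg _ _ _

theorem integral_max_zero_gaussianReal {μ σ : ℝ} (hσ : 0 < σ) :
    ∫ h, max h 0 ∂(gaussianReal μ (Real.toNNReal (σ ^ 2))) =
      μ * cdf (gaussianReal 0 1) (μ / σ) + σ * gaussianPDFReal 0 1 (-μ / σ) := by
  have hmap : gaussianReal μ (Real.toNNReal (σ ^ 2)) =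
      (gaussianReal 0 1).map (fun z => σ * z + μ) := by
    have h1 : (fun z : ℝ => σ * z + μ) = (fun z => z + μ) ∘ (fun z => σ * z) := rfl
    rw [h1, ← Measure.map_map (by fun_prop) (by fun_prop), gaussianReal_map_const_mul,
      gaussianReal_map_add_const, mul_zero, zero_add, mul_one]
    congr 1
    exact NNReal.eq (Real.coe_toNNReal _ (sq_nonneg σ))
  rw [hmap, integral_map (by fun_prop) (Continuous.aestronglyMeasurable (by fun_prop)),
    integral_gaussianReal_eq_integral_smul one_ne_zero]
  have hpos : (fun z : ℝ => gaussianPDFReal 0 1 z • max (σ * z + μ) 0) =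
      (Set.Ioi (-(μ / σ))).indicator
        (fun z => μ * gaussianPDFReal 0 1 z + σ * (z * gaussianPDFReal 0 1 z)) := by
    ext z
    have hiff : z ∈ Set.Ioi (-(μ / σ)) ↔ 0 < σ * z + μ := by
      rw [Set.mem_Ioi, ← neg_div, div_lt_iff₀ hσ]
      constructor <;> intro h <;> linarith
    by_cases hz : z ∈ Set.Ioi (-(μ / σ))
    · rw [Set.indicator_of_mem hz, max_eq_left (hiff.1 hz).le, smul_eq_mul]
      ring
    · rw [Set.indicator_of_notMem hz, max_eq_right (not_lt.1 fun h => hz (hiff.2 h)), smul_zero]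
  rw [hpos, integral_indicator measurableSet_Ioi,
    integral_add ((integrable_gaussianPDFReal 0 1).const_mul μ).integrableOn
      (integrable_mul_gaussianPDFReal.const_mul σ).integrableOn,
    integral_const_mul, integral_const_mul, setIntegral_Ioi_gaussianPDFReal,
    setIntegral_Ioi_mul_gaussianPDFReal, neg_div]

/-! ### Headways and arrivals -/

namespace TransitRoute

variable (R : TransitRoute) (n : ℕ)

theorem ae_headwayLaw_nonneg : ∀ᵐ h ∂(R.headwayLaw n), 0 ≤ h := by
  rw [headwayLaw, ae_map_iff (by fun_prop) measurableSet_Ici]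
  exact ae_of_all _ fun h => le_max_right h 0

theorem integrable_headwayLaw : Integrable (fun h : ℝ => h) (R.headwayLaw n) := by
  rw [headwayLaw, integrable_map_measure (by fun_prop) (by fun_prop)]
  exact ((memLp_id_gaussianReal 1).integrable le_rfl).pos_part

theorem integrable_exp_mul_headwayLaw (c : ℝ) :
    Integrable (fun h : ℝ => Real.exp (c * h)) (R.headwayLaw n) := by
  rw [headwayLaw, integrable_map_measure (by fun_prop) (by fun_prop)]
  refine ((integrable_const (1 : ℝ)).add (integrable_exp_mul_gaussianReal c)).mono'
    (by fun_prop) (ae_of_all _ fun h => ?_)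
  rw [Function.comp_apply, Real.norm_eq_abs, abs_of_pos (Real.exp_pos _), Pi.add_apply]
  rcases le_total h 0 with h0 | h0
  · rw [max_eq_right h0, mul_zero, Real.exp_zero]
    linarith [Real.exp_pos (c * h)]
  · rw [max_eq_left h0]
    linarith

theorem lintegral_arrivalLaw (f : ℕ → ℝ≥0∞) :
    ∫⁻ k, f k ∂(R.arrivalLaw n) =
      ∫⁻ h, ∫⁻ k, f k ∂(poissonMeasure (Real.toNNReal (R.arrivalRate n * h)))
        ∂(R.headwayLaw n) :=
  Measure.lintegral_bind (R.measurable_poisson_family n).aemeasurable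
    Measurable.of_discrete.aemeasurable

theorem arrivalLaw_real_zero_pos : 0 < (R.arrivalLaw n).real {0} := by
  refine measureReal_nonneg.lt_of_ne' fun h => ?_
  have hm : Measurable fun h : ℝ => poissonMeasure (Real.toNNReal (R.arrivalRate n * h)) {0} :=
    (Measure.measurable_coe (measurableSet_singleton _)).comp (R.measurable_poisson_family n)
  rw [measureReal_eq_zero_iff, arrivalLaw, Measure.bind_apply (measurableSet_singleton _)
    (R.measurable_poisson_family n).aemeasurable, lintegral_eq_zero_iff hm] at h
  obtain ⟨x, hx⟩ := h.exists
  simp only [poissonMeasure_singleton, Pi.zero_apply, ENNReal.ofReal_eq_zero, pow_zero, mul_one,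
    Nat.factorial_zero, Nat.cast_one, div_one] at hx
  exact absurd hx (not_le.2 (Real.exp_pos _))

theorem integrable_exp_mul_arrivalLaw (hlam : 0 ≤ R.arrivalRate n) (t : ℝ) :
    Integrable (fun k : ℕ => Real.exp (t * k)) (R.arrivalLaw n) := by
  refine ⟨Measurable.of_discrete.aestronglyMeasurable, ?_⟩
  rw [hasFiniteIntegral_iff_ofReal (ae_of_all _ fun k => (Real.exp_pos _).le),
    lintegral_arrivalLaw]
  simp_rw [lintegral_exp_poissonMeasure]
  have h := (R.integrable_exp_mul_headwayLaw n ((Real.exp t - 1) * R.arrivalRate n)).2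
  rw [hasFiniteIntegral_iff_ofReal (ae_of_all _ fun k => (Real.exp_pos _).le)] at h
  refine lt_of_le_of_lt (le_of_eq (lintegral_congr_ae ?_)) h
  filter_upwards [R.ae_headwayLaw_nonneg n] with x hx
  rw [Real.coe_toNNReal _ (mul_nonneg hlam hx), mul_assoc]

theorem lintegral_natCast_arrivalLaw :
    ∫⁻ k, ENNReal.ofReal (k : ℝ) ∂(R.arrivalLaw n) =
      ∫⁻ h, ENNReal.ofReal (R.arrivalRate n * h) ∂(R.headwayLaw n) := by
  rw [lintegral_arrivalLaw]
  simp_rw [lintegral_natCast_poissonMeasure]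
  rfl

theorem integrable_natCast_arrivalLaw (hlam : 0 ≤ R.arrivalRate n) :
    Integrable (fun k : ℕ => (k : ℝ)) (R.arrivalLaw n) := by
  refine ⟨Measurable.of_discrete.aestronglyMeasurable, ?_⟩
  rw [hasFiniteIntegral_iff_ofReal (ae_of_all _ fun k => Nat.cast_nonneg k),
    lintegral_natCast_arrivalLaw]
  have h := ((R.integrable_headwayLaw n).const_mul (R.arrivalRate n)).2
  rwa [hasFiniteIntegral_iff_ofReal] at h
  filter_upwards [R.ae_headwayLaw_nonneg n] with x hx using mul_nonneg hlam hx

theorem meanArrivals_eq (hlam : 0 ≤ R.arrivalRate n) :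
    R.meanArrivals n = R.arrivalRate n * ∫ h, h ∂(R.headwayLaw n) := by
  rw [meanArrivals, integral_eq_lintegral_of_nonneg_ae (ae_of_all _ fun k => Nat.cast_nonneg k)
    Measurable.of_discrete.aestronglyMeasurable, lintegral_natCast_arrivalLaw,
    ← integral_const_mul, integral_eq_lintegral_of_nonneg_ae _
      ((R.integrable_headwayLaw n).const_mul (R.arrivalRate n)).1]
  filter_upwards [R.ae_headwayLaw_nonneg n] with x hx using mul_nonneg hlam hx

end TransitRoute

theorem proposition12 (R : TransitRoute) (n : ℕ) (hn : 1 ≤ n) (hnN : n ≤ R.numStations)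
    (s : ℕ → PMF (Fin (R.capacity + 1))) (s_lim : PMF (Fin (R.capacity + 1)))
    (hs : ∀ u, Tendsto (fun l => s l u) atTop (𝓝 (s_lim u)))
    (hpos : 0 < meanSpace s_lim) :
    (IsStableQueue s (R.arrivalLaw n) ↔ R.utilization n s_lim < 1) ∧
    Integrable (fun k : ℕ => (k : ℝ)) (R.arrivalLaw n) ∧
    Integrable (fun h : ℝ => h) (R.headwayLaw n) ∧
    R.utilization n s_lim =
      R.arrivalRate n * (∫ h, h ∂(R.headwayLaw n)) / meanSpace s_lim ∧
    (0 < R.incidentRate →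
      R.utilization n s_lim =
        (R.headwayMean * cdf (gaussianReal 0 1) (R.headwayMean / R.headwaySD n) +
            R.headwaySD n * gaussianPDFReal 0 1 (-R.headwayMean / R.headwaySD n)) *
          R.arrivalRate n / meanSpace s_lim) := by
  have hlam := R.arrivalRate_nonneg n hn hnN
  have hY := R.integrable_natCast_arrivalLaw n hlam
  have hmean := R.meanArrivals_eq n hlam
  refine ⟨?_, hY, R.integrable_headwayLaw n, by rw [TransitRoute.utilization, hmean], fun hγ => ?_⟩
  · rw [TransitRoute.utilization, div_lt_one hpos]
    exact isStableQueue_iff_integral_lt_meanSpace hs hpos hY (R.arrivalLaw_real_zero_pos n)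
      (R.integrable_exp_mul_arrivalLaw n hlam)
  · have hσ : 0 < R.headwaySD n := by
      have h1 := R.travelTime_pos n hn hnN
      have h2 := R.recoveryRate_pos
      unfold TransitRoute.headwaySD
      positivity
    rw [TransitRoute.utilization, hmean, TransitRoute.headwayLaw,
      integral_map (by fun_prop) (by fun_prop), integral_max_zero_gaussianReal hσ, mul_comm]
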